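/- All graphs are finite and simple. Let $k\ge 1$ and let $G$ be a graph with vertex set $V(G)$. A set $S\subseteq V(G)$ is a $k$-dominating set of $G$ if every vertex in $V(G)\setminus S$ has at least $k$ neighbors in $S$. Two disjoint sets $A,B\subseteq V(G)$ form a $k$-coalition if neither $A$ nor $B$ is a $k$-dominating set of $G$ but $A\cup B$ is. A $k$-coalition partition of $G$ is a partition of $V(G)$ into nonempty sets, each of which either is a $k$-dominating set of cardinality $k$ or forms a $k$-coalition with another set of the partition. The $k$-coalition number $C_k(G)$ is the maximum cardinality of a $k$-coalition partition of $G$. Let $P_m$ denote the path on $m$ vertices, and for $a,b\ge 1$ let the double star $S_{a,b}$ be the tree with exactly two non-leaf vertices, which are adjacent, one having $a$ leaf neighbors and the other $b$ leaf neighbors. Theorem. If $T$ is a tree of order $n\ge 2$, then $$C_2(T)\le \left\lfloor \frac n2\right\rfloor+1,$$ with equality if and only if $T$ is isomorphic to one of $P_2$, $P_3$, $P_4$, $P_5$, $S_{1,2}$. -/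

import Mathlib

namespace KCoalition

/-- `S` is a `k`-dominating set of `G`: every vertex outside `S` has at least `k` neighbors
in `S`. -/
def IsKDominating {V : Type*} (G : SimpleGraph V) [DecidableRel G.Adj] (k : ℕ)
    (S : Finset V) : Prop :=
  ∀ v : V, v ∉ S → k ≤ (S.filter fun w => G.Adj v w).card

/-- Two disjoint sets `A` and `B` form a `k`-coalition in `G`: neither is a `k`-dominating set,
but their union is. -/
def FormKCoalition {V : Type*} [DecidableEq V] (G : SimpleGraph V) [DecidableRel G.Adj] (k : ℕ)
    (A B : Finset V) : Prop :=
  Disjoint A B ∧ ¬ IsKDominating G k A ∧ ¬ IsKDominating G k B ∧ IsKDominating G k (A ∪ B)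

/-- A partition of the vertex set (into nonempty parts) is a `k`-coalition partition if each part
is a `k`-dominating set of cardinality `k` or forms a `k`-coalition with another part. -/
def IsKCoalitionPartition {V : Type*} [Fintype V] [DecidableEq V] (G : SimpleGraph V)
    [DecidableRel G.Adj] (k : ℕ) (P : Finpartition (Finset.univ : Finset V)) : Prop :=
  ∀ A ∈ P.parts, (IsKDominating G k A ∧ A.card = k) ∨
    ∃ B ∈ P.parts, B ≠ A ∧ FormKCoalition G k A B

/-- The `k`-coalition number `C_k(G)`: the maximum number of parts of a `k`-coalition partition
of `G`. The set of these numbers is bounded by the order of `G`, see `bddAbove_card_parts`. -/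
noncomputable def coalitionNumber {V : Type*} [Fintype V] [DecidableEq V] (k : ℕ)
    (G : SimpleGraph V) [DecidableRel G.Adj] : ℕ :=
  sSup {m : ℕ | ∃ P : Finpartition (Finset.univ : Finset V),
    IsKCoalitionPartition G k P ∧ P.parts.card = m}

theorem bddAbove_card_parts {V : Type*} [Fintype V] [DecidableEq V] (k : ℕ)
    (G : SimpleGraph V) [DecidableRel G.Adj] :
    BddAbove {m : ℕ | ∃ P : Finpartition (Finset.univ : Finset V),
      IsKCoalitionPartition G k P ∧ P.parts.card = m} := by
  refine ⟨Fintype.card V, ?_⟩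
  rintro m ⟨P, -, rfl⟩
  exact P.card_parts_le_card

/-- The double star `S_{a,b}`: two adjacent central vertices `inl 0` and `inl 1`, with `a` leaves
attached to the first one and `b` leaves attached to the second one. -/
def doubleStar (a b : ℕ) : SimpleGraph (Fin 2 ⊕ (Fin a ⊕ Fin b)) :=
  SimpleGraph.fromRel fun u v =>
    (u = Sum.inl 0 ∧ v = Sum.inl 1) ∨
    (u = Sum.inl 0 ∧ ∃ i : Fin a, v = Sum.inr (Sum.inl i)) ∨
    (u = Sum.inl 1 ∧ ∃ j : Fin b, v = Sum.inr (Sum.inr j))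

end KCoalition

namespace KCoalition

open Finset SimpleGraph

set_option linter.unusedSectionVars false

/-! ### 2-domination, transport along isomorphisms, and partitions from colourings. -/

section Domination

variable {V : Type*} [Fintype V] [DecidableEq V] {G : SimpleGraph V} [DecidableRel G.Adj] {k : ℕ}

/-! A 2-dominating set contains every leaf, so in a 2-coalition partition with m ≥ 3 parts a single
part A holds all leaves and every other part is its partner (`exists_leaf_part`). Take v outside A
with d < 2 neighbours in A. Each of the m - 2 parts other than A and that of v contains at least 2 -
d neighbours of v, none of them a leaf. In a tree of order n the degrees of the neighbours of v sum
to at most n - 1, so 2(2 - d)(m - 2) + d + 1 ≤ n, which gives the bound. For m ≥ 4 those neighbours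
even have degree at least 3, which excludes equality (`card_parts_bound`). Hence equality forces n ≤
5, and small trees remain; explicit colourings show that the five listed ones attain it. -/

theorem card_filter_adj_le_degree (S : Finset V) (v : V) :
    (S.filter fun w => G.Adj v w).card ≤ G.degree v := by
  rw [← card_neighborFinset_eq_degree]
  exact card_le_card fun w hw => by simpa using (mem_filter.1 hw).2

theorem IsKDominating.mem_of_degree_lt {S : Finset V} (hS : IsKDominating G k S) {v : V}
    (hv : G.degree v < k) : v ∈ S := by
  by_contra h
  exact absurd ((hS v h).trans (card_filter_adj_le_degree S v)) (by omega)

theorem isKDominating_iff_of_iso {W : Type*} [Fintype W] [DecidableEq W] {H : SimpleGraph W}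
    [DecidableRel H.Adj] (e : G ≃g H) (p : W → Prop) [DecidablePred p] :
    IsKDominating G k (univ.filter fun v => p (e v)) ↔ IsKDominating H k (univ.filter p) := by
  have key (v : V) : ((univ.filter fun v => p (e v)).filter fun w => G.Adj v w).card =
      ((univ.filter p).filter fun w => H.Adj (e v) w).card := by
    refine card_bij (fun w _ => e w) ?_ (fun _ _ _ _ h => e.injective h) ?_
    · intro w hw
      simpa [e.map_adj_iff] using hw
    · intro w hw
      obtain ⟨u, rfl⟩ := e.surjective w
      exact ⟨u, by simpa [e.map_adj_iff] using hw, rfl⟩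
  unfold IsKDominating
  rw [e.surjective.forall]
  simp only [key, mem_filter, mem_univ, true_and]

theorem IsKCoalitionPartition.card_parts_le_coalitionNumber
    {P : Finpartition (univ : Finset V)} (hP : IsKCoalitionPartition G k P) :
    P.parts.card ≤ coalitionNumber k G :=
  le_csSup (bddAbove_card_parts k G) ⟨P, hP, rfl⟩

theorem exists_isKCoalitionPartition_of_coalitionNumber_pos (h : 0 < coalitionNumber k G) :
    ∃ P : Finpartition (univ : Finset V),
      IsKCoalitionPartition G k P ∧ P.parts.card = coalitionNumber k G := by
  -- Since `sSup ∅ = 0`, positivity is what ensures that some partition exists.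
  refine Nat.sSup_mem (Set.nonempty_iff_ne_empty.2 fun h0 => ?_) (bddAbove_card_parts k G)
  rw [coalitionNumber, h0] at h
  simp at h

/-- The partition of a finite type into the fibres of a surjection. -/
def fiberPartition {ι : Type*} [Fintype ι] [DecidableEq ι] (c : V → ι)
    (hc : Function.Surjective c) : Finpartition (univ : Finset V) :=
  Finpartition.ofExistsUnique (univ.image fun i => univ.filter fun v => c v = i)
    (fun _ _ => subset_univ _)
    (fun a _ => by
      refine ⟨univ.filter fun v => c v = c a, by simp, ?_⟩
      simp only [mem_image, mem_univ, true_and]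
      rintro _ ⟨⟨i, rfl⟩, hi⟩
      simp only [mem_filter, mem_univ, true_and] at hi
      rw [hi])
    (by
      simp only [mem_image, mem_univ, true_and, not_exists]
      intro i hi
      obtain ⟨v, hv⟩ := hc i
      have : v ∈ univ.filter fun v => c v = i := by simpa using hv
      simp [hi] at this)

theorem fiber_injective {ι : Type*} [DecidableEq ι] (c : V → ι)
    (hc : Function.Surjective c) :
    Function.Injective fun i => univ.filter fun v => c v = i := by
  intro i j hij
  obtain ⟨v, hv⟩ := hc i
  have : v ∈ univ.filter fun v => c v = i := by simpa using hv
  rw [show (univ.filter fun v => c v = i) = univ.filter fun v => c v = j from hij] at this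
  exact hv.symm.trans (by simpa using this)

/-- Puts the colouring on the concrete graph `H`, where its conditions can be settled by `decide`.
-/
theorem card_le_coalitionNumber_of_iso {W ι : Type*} [Fintype W] [DecidableEq W] [Fintype ι]
    [DecidableEq ι] {H : SimpleGraph W} [DecidableRel H.Adj] (e : G ≃g H) (c : W → ι)
    (hc : Function.Surjective c)
    (h : ∀ i, ∃ j, j ≠ i ∧ FormKCoalition H k (univ.filter fun w => c w = i)
      (univ.filter fun w => c w = j)) :
    Fintype.card ι ≤ coalitionNumber k G := by
  have hce : Function.Surjective fun v => c (e v) := hc.comp e.surjective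
  have hP : IsKCoalitionPartition G k (fiberPartition (fun v => c (e v)) hce) := by
    intro A hA
    obtain ⟨i, -, rfl⟩ := mem_image.1 hA
    obtain ⟨j, hji, -, h1, h2, h3⟩ := h i
    refine Or.inr ⟨univ.filter fun v => c (e v) = j, mem_image_of_mem _ (mem_univ j),
      (fiber_injective _ hce).ne hji, ?_, ?_, ?_, ?_⟩
    · rw [disjoint_filter]
      intro v _ hi hj
      exact hji (hj.symm.trans hi)
    · rwa [isKDominating_iff_of_iso e fun w => c w = i]
    · rwa [isKDominating_iff_of_iso e fun w => c w = j]
    · rw [← filter_or] at h3 ⊢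
      rwa [isKDominating_iff_of_iso e fun w => c w = i ∨ c w = j]
  refine le_trans (le_of_eq ?_) hP.card_parts_le_coalitionNumber
  exact (card_image_of_injective _ (fiber_injective _ hce)).symm

end Domination

/-! ### Recognising trees with at most five vertices. -/

section Classification

variable {V : Type*} [Fintype V] [DecidableEq V] {T : SimpleGraph V} [DecidableRel T.Adj]

/-- Trees are the maximal acyclic graphs, so the acyclic pullback of `T`, which contains the
connected graph `H`, has no further edges. Recognising a tree thus only requires exhibiting edges,
never non-edges. -/
theorem nonempty_iso_of_connected_of_isAcyclic {W : Type*} [Fintype W] {H : SimpleGraph W}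
    (hH : H.Connected) (hT : T.IsAcyclic) (f : W → V) (hf : Function.Injective f)
    (hcard : Fintype.card W = Fintype.card V) (hadj : ∀ x y, H.Adj x y → T.Adj (f x) (f y)) :
    Nonempty (T ≃g H) := by
  have hle : H ≤ T.comap f := fun x y h => hadj x y h
  have hac : (T.comap f).IsAcyclic := hT.of_comap ⟨f, hf⟩
  have hmax := (isTree_iff_maximal_isAcyclic.1 ⟨hH, hac.anti hle⟩).2
  have hge : T.comap f ≤ H := hmax.2 hac hle
  let e : W ≃ V := Equiv.ofBijective f ((Fintype.bijective_iff_injective_and_card f).2 ⟨hf, hcard⟩)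
  exact ⟨(RelIso.mk e fun {x y} => ⟨fun h => hge h, fun h => hle h⟩ : H ≃g T).symm⟩

theorem connected_doubleStar (a b : ℕ) : (doubleStar a b).Connected := by
  have h : ∀ v, (doubleStar a b).Reachable (Sum.inl 0) v := by
    have h1 : (doubleStar a b).Reachable (Sum.inl 0) (Sum.inl 1) :=
      Adj.reachable (by simp [doubleStar])
    rintro (i | i | j)
    · fin_cases i
      · exact Reachable.refl _
      · exact h1
    · exact Adj.reachable (by simp [doubleStar])
    · exact h1.trans (Adj.reachable (by simp [doubleStar]))
  have : Nonempty (Fin 2 ⊕ (Fin a ⊕ Fin b)) := ⟨Sum.inl 0⟩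
  exact ⟨fun u v => (h u).symm.trans (h v)⟩

theorem nonempty_iso_pathGraph_two (hT : T.IsTree) (hcard : Fintype.card V = 2) :
    Nonempty (T ≃g pathGraph 2) := by
  have : Nontrivial V := Fintype.one_lt_card_iff_nontrivial.1 (by omega)
  obtain ⟨u⟩ := hT.connected.nonempty
  obtain ⟨v, huv⟩ := (T.degree_pos_iff_exists_adj u).1
    (hT.connected.preconnected.degree_pos_of_nontrivial u)
  have h1 := huv.ne
  refine nonempty_iso_of_connected_of_isAcyclic (pathGraph_connected 1) hT.isAcyclic ![u, v]
    ?_ (by simpa using hcard.symm) ?_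
  · intro x y h
    fin_cases x <;> fin_cases y <;> simp_all
  · intro x y h
    fin_cases x <;> fin_cases y <;> simp_all [pathGraph_adj, T.adj_comm]

theorem exists_adj_ne_of_two_le_degree {v : V} (hv : 2 ≤ T.degree v) (u : V) :
    ∃ w, T.Adj v w ∧ w ≠ u := by
  rw [← card_neighborFinset_eq_degree] at hv
  obtain ⟨w, hw, hne⟩ := exists_mem_ne (Nat.lt_of_succ_le hv) u
  exact ⟨w, by simpa using hw, hne⟩

theorem sum_degree_add_two (hT : T.IsTree) : ∑ v, T.degree v + 2 = 2 * Fintype.card V := by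
  rw [sum_degrees_eq_twice_card_edges, ← hT.card_edgeFinset]
  ring

theorem nonempty_iso_pathGraph_three (hT : T.IsTree) (hcard : Fintype.card V = 3) :
    Nonempty (T ≃g pathGraph 3) := by
  obtain ⟨v, hv⟩ : ∃ v, 2 ≤ T.degree v := by
    by_contra! h
    have h1 := sum_degree_add_two hT
    have h2 : ∑ v, T.degree v ≤ ∑ _v : V, 1 := sum_le_sum fun v _ => by have := h v; omega
    simp [hcard] at h1 h2
    omega
  obtain ⟨a, hva, -⟩ := exists_adj_ne_of_two_le_degree hv v
  obtain ⟨b, hvb, hba⟩ := exists_adj_ne_of_two_le_degree hv a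
  have h1 := hva.ne
  have h2 := hvb.ne
  refine nonempty_iso_of_connected_of_isAcyclic (pathGraph_connected 2) hT.isAcyclic ![a, v, b]
    ?_ (by simpa using hcard.symm) ?_
  · intro x y h
    fin_cases x <;> fin_cases y <;> simp_all
  · intro x y h
    fin_cases x <;> fin_cases y <;> simp_all [pathGraph_adj, T.adj_comm]

/-- Two adjacent non-leaf vertices of an acyclic graph are the middle of a path on four vertices. -/
theorem exists_path_of_adj (hT : T.IsAcyclic) {u v : V} (huv : T.Adj u v)
    (hu : 2 ≤ T.degree u) (hv : 2 ≤ T.degree v) :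
    ∃ a b, T.Adj a u ∧ T.Adj v b ∧ a ≠ v ∧ b ≠ u ∧ a ≠ b := by
  obtain ⟨a, hua, hav⟩ := exists_adj_ne_of_two_le_degree hu v
  obtain ⟨b, hvb, hbu⟩ := exists_adj_ne_of_two_le_degree hv u
  refine ⟨a, b, hua.symm, hvb, hav, hbu, ?_⟩
  rintro rfl
  exact hT.cliqueFree le_rfl {u, v, a} (is3Clique_triple_iff.2 ⟨huv, hua, hvb⟩)

theorem nonempty_iso_pathGraph_four (hT : T.IsTree) (hcard : Fintype.card V = 4) {u v : V}
    (huv : T.Adj u v) (hu : 2 ≤ T.degree u) (hv : 2 ≤ T.degree v) :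
    Nonempty (T ≃g pathGraph 4) := by
  obtain ⟨a, b, hau, hvb, hav, hbu, hab⟩ := exists_path_of_adj hT.isAcyclic huv hu hv
  have h1 := huv.ne
  have h2 := hau.ne
  have h3 := hvb.ne
  refine nonempty_iso_of_connected_of_isAcyclic (pathGraph_connected 3) hT.isAcyclic ![a, u, v, b]
    ?_ (by simpa using hcard.symm) ?_
  · intro x y h
    fin_cases x <;> fin_cases y <;> simp_all
  · intro x y h
    fin_cases x <;> fin_cases y <;> simp_all [pathGraph_adj, T.adj_comm]

theorem nonempty_iso_pathGraph_five (hT : T.IsAcyclic) (hcard : Fintype.card V = 5)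
    (f : Fin 5 → V) (hf : Function.Injective f) (h : ∀ i : Fin 4, T.Adj (f i.castSucc) (f i.succ)) :
    Nonempty (T ≃g pathGraph 5) := by
  refine nonempty_iso_of_connected_of_isAcyclic (pathGraph_connected 4) hT f hf
    (by simpa using hcard.symm) ?_
  have key (x y : Fin 5) (hxy : x.val + 1 = y.val) : T.Adj (f x) (f y) := by
    have := h ⟨x, by omega⟩
    rwa [show Fin.castSucc ⟨x, _⟩ = x from rfl,
      show Fin.succ ⟨x, _⟩ = y from Fin.ext hxy] at this
  intro x y hxy
  rcases pathGraph_adj.1 hxy with h | h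
  · exact key x y h
  · exact (key y x h).symm

theorem nonempty_iso_doubleStar_one_two (hT : T.IsAcyclic) (hcard : Fintype.card V = 5)
    {x u v y z : V} (hnd : [u, v, x, y, z].Nodup) (huv : T.Adj u v) (hux : T.Adj u x)
    (hvy : T.Adj v y) (hvz : T.Adj v z) :
    Nonempty (T ≃g doubleStar 1 2) := by
  refine nonempty_iso_of_connected_of_isAcyclic (connected_doubleStar 1 2) hT
    (Sum.elim ![u, v] (Sum.elim ![x] ![y, z])) ?_ (by simpa using hcard.symm) ?_
  · rintro (i | i | i) (j | j | j) h <;> fin_cases i <;> fin_cases j <;> simp_all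
  · rintro (i | i | i) (j | j | j) h <;> fin_cases i <;> fin_cases j <;>
      simp_all [doubleStar, T.adj_comm]

theorem nonempty_iso_of_card_eq_five (hT : T.IsTree) (hcard : Fintype.card V = 5) {u v : V}
    (huv : T.Adj u v) (hu : 2 ≤ T.degree u) (hv : 2 ≤ T.degree v) :
    Nonempty (T ≃g pathGraph 5) ∨ Nonempty (T ≃g doubleStar 1 2) := by
  obtain ⟨a, b, hau, hvb, hav, hbu, hab⟩ := exists_path_of_adj hT.isAcyclic huv hu hv
  have h1 := huv.ne
  have h2 := hau.ne
  have h3 := hvb.ne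
  have hS : ({a, u, v, b} : Finset V).card = 4 := by
    simp [card_insert_of_notMem, *, hbu.symm]
  obtain ⟨c, hc⟩ : ∃ c, c ∉ ({a, u, v, b} : Finset V) := by
    by_contra! h
    have : ({a, u, v, b} : Finset V) = univ := eq_univ_iff_forall.2 h
    rw [this, card_univ] at hS
    omega
  have huniv : insert c ({a, u, v, b} : Finset V) = univ := by
    rw [← card_eq_iff_eq_univ, card_insert_of_notMem hc, hS, hcard]
  have : Nontrivial V := ⟨u, v, h1⟩
  obtain ⟨w, hcw⟩ := (T.degree_pos_iff_exists_adj c).1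
    (hT.connected.preconnected.degree_pos_of_nontrivial c)
  have hw : w ∈ insert c ({a, u, v, b} : Finset V) := huniv ▸ mem_univ w
  simp only [mem_insert, mem_singleton, not_or] at hw hc
  obtain ⟨hca, hcu, hcv, hcb⟩ := hc
  -- The fifth vertex hangs on the path a-u-v-b: at an end it gives the path, at an inner vertex the
  -- double star.
  rcases hw with rfl | rfl | rfl | rfl | rfl
  · exact absurd rfl hcw.ne
  · refine Or.inl (nonempty_iso_pathGraph_five hT.isAcyclic hcard ![c, w, u, v, b] ?_ ?_)
    · rw [← List.nodup_ofFn]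
      simp [*, hbu.symm]
    · intro i
      fin_cases i <;> simp [*]
  · refine Or.inr (nonempty_iso_doubleStar_one_two hT.isAcyclic hcard (u := v) (v := w)
      (x := b) (y := a) (z := c) ?_ huv.symm hvb hau.symm hcw.symm)
    simp
    grind
  · refine Or.inr (nonempty_iso_doubleStar_one_two hT.isAcyclic hcard (u := u) (v := w)
      (x := a) (y := b) (z := c) ?_ huv hau.symm hvb hcw.symm)
    simp
    grind
  · refine Or.inl (nonempty_iso_pathGraph_five hT.isAcyclic hcard ![a, u, v, w, c] ?_ ?_)
    · rw [← List.nodup_ofFn]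
      simp
      grind
    · intro i
      fin_cases i <;> simp [*, hcw.symm]

end Classification

/-! ### The upper bound and the equality case. -/

section UpperBound

variable {V : Type*} [Fintype V] [DecidableEq V] {T : SimpleGraph V} [DecidableRel T.Adj]

/-- The total degree is 2n - 2; `v` accounts for deg v of it and the n - 1 - deg v vertices outside
its closed neighbourhood for at least 1 each. -/
theorem sum_degree_neighborFinset_lt_card (hT : T.IsTree) [Nontrivial V] (v : V) :
    ∑ u ∈ T.neighborFinset v, T.degree u + 1 ≤ Fintype.card V := by
  have hpos := fun u => hT.connected.preconnected.degree_pos_of_nontrivial u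
  have hv : v ∉ T.neighborFinset v := by simp
  set S := insert v (T.neighborFinset v) with hS
  have h1 : ∑ u ∈ S, T.degree u + ∑ u ∈ Sᶜ, T.degree u = ∑ u, T.degree u :=
    sum_add_sum_compl S _
  have h2 : ∑ u ∈ S, T.degree u = T.degree v + ∑ u ∈ T.neighborFinset v, T.degree u :=
    sum_insert hv
  have h3 : Sᶜ.card ≤ ∑ u ∈ Sᶜ, T.degree u := by
    rw [card_eq_sum_ones]
    exact sum_le_sum fun u _ => hpos u
  have h4 : S.card = T.degree v + 1 := by
    rw [hS, card_insert_of_notMem hv, card_neighborFinset_eq_degree]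
  have h5 := card_add_card_compl S
  have h6 := sum_degree_add_two hT
  omega

/-- In a 2-coalition partition of a tree with at least three parts, one part contains all leaves,
is not 2-dominating, and forms a 2-dominating set with any other part. -/
theorem exists_leaf_part (hT : T.IsTree) [Nontrivial V] {P : Finpartition (univ : Finset V)}
    (hP : IsKCoalitionPartition T 2 P) (hm : 3 ≤ P.parts.card) :
    ∃ A ∈ P.parts, ¬ IsKDominating T 2 A ∧ (∀ v, v ∉ A → 2 ≤ T.degree v) ∧
      ∀ B ∈ P.parts, B ≠ A → IsKDominating T 2 (A ∪ B) := by
  obtain ⟨ℓ, -, -, hℓ, -⟩ := hT.exists_ne_and_degree_eq_one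
  obtain ⟨A, hA, hℓA⟩ := P.exists_mem (mem_univ ℓ)
  have key : ∀ B ∈ P.parts, B ≠ A → ¬ IsKDominating T 2 A ∧ IsKDominating T 2 (A ∪ B) := by
    intro B hB hBA
    have hℓB : ℓ ∉ B := fun h => hBA (P.eq_of_mem_parts hB hA h hℓA)
    rcases hP B hB with ⟨h, -⟩ | ⟨C, hC, -, -, -, hCd, hU⟩
    · exact absurd (h.mem_of_degree_lt (by omega)) hℓB
    · have hℓC : ℓ ∈ C :=
        (mem_union.1 (hU.mem_of_degree_lt (by omega : T.degree ℓ < 2))).resolve_left hℓB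
      obtain rfl := P.eq_of_mem_parts hC hA hℓC hℓA
      exact ⟨hCd, union_comm B C ▸ hU⟩
  have hcard : 1 < (P.parts.erase A).card := by
    rw [card_erase_of_mem hA]
    omega
  obtain ⟨B, hB, C, hC, hBC⟩ := one_lt_card.1 hcard
  obtain ⟨hBA, hB⟩ := mem_erase.1 hB
  obtain ⟨hCA, hC⟩ := mem_erase.1 hC
  refine ⟨A, hA, (key B hB hBA).1, fun v hv => ?_, fun B hB hBA => (key B hB hBA).2⟩
  -- A leaf outside `A` would lie in both `B` and `C`; this is where three parts are needed.
  by_contra! hlt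
  have h1 := (mem_union.1 ((key B hB hBA).2.mem_of_degree_lt hlt)).resolve_left hv
  have h2 := (mem_union.1 ((key C hC hCA).2.mem_of_degree_lt hlt)).resolve_left hv
  exact hBC (P.eq_of_mem_parts hB hC h1 h2)

theorem card_filter_adj_union {A B : Finset V} (h : Disjoint A B) (v : V) :
    ((A ∪ B).filter fun w => T.Adj v w).card =
      (A.filter fun w => T.Adj v w).card + (B.filter fun w => T.Adj v w).card := by
  rw [filter_union, card_union_of_disjoint (disjoint_filter_filter h)]

/-- Splits the degree sum over the neighbours of `v` by parts: `A` contributes at least d, its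
number of neighbours of `v`, and each part other than `A` and `B` at least (2 - d)c, because its
union with `A` dominates `v`. -/
theorem bound_of_le_degree (hT : T.IsTree) [Nontrivial V] {P : Finpartition (univ : Finset V)}
    {A B : Finset V} {v : V} {c : ℕ} (hA : A ∈ P.parts) (hB : B ∈ P.parts) (hAB : B ≠ A)
    (hv : v ∈ B) (hdom : ∀ C ∈ P.parts, C ≠ A → IsKDominating T 2 (A ∪ C))
    (hc : ∀ C ∈ P.parts, C ≠ A → C ≠ B → ∀ u ∈ C, T.Adj v u → c ≤ T.degree u) :
    (P.parts.card - 2) * ((2 - (A.filter fun w => T.Adj v w).card) * c) +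
      (A.filter fun w => T.Adj v w).card + 1 ≤ Fintype.card V := by
  have hvA : v ∉ A := fun h => hAB (P.eq_of_mem_parts hB hA hv h)
  set d := (A.filter fun w => T.Adj v w).card with hd
  let g : V → ℕ := fun u => if T.Adj v u then T.degree u else 0
  have hg (S : Finset V) : ∑ u ∈ S, g u = ∑ u ∈ S.filter (fun w => T.Adj v w), T.degree u :=
    (sum_filter _ _).symm
  have h0 := sum_degree_neighborFinset_lt_card hT v
  have h1 : ∑ u ∈ T.neighborFinset v, T.degree u = ∑ C ∈ P.parts, ∑ u ∈ C, g u := by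
    have := sum_biUnion (f := g) (s := P.parts) (t := id) P.disjoint
    rw [P.biUnion_parts] at this
    simp only [id] at this
    rw [← this, hg, neighborFinset_eq_filter]
  have hBA' : B ∈ P.parts.erase A := mem_erase.2 ⟨hAB, hB⟩
  rw [h1, ← add_sum_erase _ _ hA, ← add_sum_erase _ _ hBA'] at h0
  have h2 : d ≤ ∑ u ∈ A, g u := by
    rw [hg]
    rw [hd, card_eq_sum_ones]
    exact sum_le_sum fun u _ => hT.connected.preconnected.degree_pos_of_nontrivial u
  have h3 : (P.parts.card - 2) * ((2 - d) * c) ≤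
      ∑ C ∈ (P.parts.erase A).erase B, ∑ u ∈ C, g u := by
    have : ((P.parts.erase A).erase B).card = P.parts.card - 2 := by
      rw [card_erase_of_mem hBA', card_erase_of_mem hA]
      omega
    rw [← this, ← smul_eq_mul]
    refine card_nsmul_le_sum _ _ _ fun C hC => ?_
    obtain ⟨hCB, hC⟩ := mem_erase.1 hC
    obtain ⟨hCA, hC⟩ := mem_erase.1 hC
    have hvC : v ∉ C := fun h => hCB (P.eq_of_mem_parts hC hB h hv)
    have h4 := hdom C hC hCA v (by simp [hvA, hvC])
    rw [card_filter_adj_union (show Disjoint A C from P.disjoint hA hC hCA.symm)] at h4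
    calc (2 - d) * c ≤ (C.filter fun w => T.Adj v w).card * c :=
          Nat.mul_le_mul_right _ (by omega)
      _ ≤ ∑ u ∈ C, g u := by
          rw [hg, ← smul_eq_mul]
          refine card_nsmul_le_sum _ _ _ fun u hu => ?_
          obtain ⟨hu, hvu⟩ := mem_filter.1 hu
          exact hc C hC hCA hCB u hu hvu
  omega

/-- The order of a tree with a 2-coalition partition into at least three parts. -/
theorem card_parts_bound (hT : T.IsTree) [Nontrivial V] {P : Finpartition (univ : Finset V)}
    (hP : IsKCoalitionPartition T 2 P) (hm : 3 ≤ P.parts.card) :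
    P.parts.card ≤ Fintype.card V / 2 + 1 ∧ (P.parts.card = Fintype.card V / 2 + 1 →
      P.parts.card = 3 ∧ ∃ u v, T.Adj u v ∧ 2 ≤ T.degree u ∧ 2 ≤ T.degree v) := by
  obtain ⟨A, hA, hnd, hdeg, hdom⟩ := exists_leaf_part hT hP hm
  obtain ⟨v, hvA, hd⟩ : ∃ v, v ∉ A ∧ (A.filter fun w => T.Adj v w).card < 2 := by
    simpa [IsKDominating] using hnd
  obtain ⟨B, hB, hvB⟩ := P.exists_mem (mem_univ v)
  have hBA : B ≠ A := fun h => hvA (h ▸ hvB)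
  have hmem {C D : Finset V} (hC : C ∈ P.parts) (hD : D ∈ P.parts) (h : C ≠ D) {u : V}
      (hu : u ∈ C) : u ∉ D := fun h' => h (P.eq_of_mem_parts hC hD hu h')
  have b2 := bound_of_le_degree hT (c := 2) hA hB hBA hvB hdom
    fun C hC hCA _ u hu _ => hdeg u (hmem hC hA hCA hu)
  have third (C : Finset V) (hm' : 4 ≤ P.parts.card) :
      ∃ D ∈ P.parts, D ≠ A ∧ D ≠ B ∧ D ≠ C := by
    have : (P.parts \ {A, B, C}).Nonempty := by
      rw [← card_pos]
      have h1 := le_card_sdiff {A, B, C} P.parts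
      have h2 : ({A, B, C} : Finset (Finset V)).card ≤ 3 := card_le_three
      omega
    obtain ⟨D, hD⟩ := this
    simp only [mem_sdiff, mem_insert, mem_singleton, not_or] at hD
    exact ⟨D, hD.1, hD.2⟩
  -- A fourth part `D` gives `u` two neighbours in `A ∪ D`, and `v` is a third one.
  have b3 (hm' : 4 ≤ P.parts.card) := bound_of_le_degree hT (c := 3) hA hB hBA hvB hdom
    fun C hC hCA hCB u hu hvu => by
      obtain ⟨D, hD, hDA, hDB, hDC⟩ := third C hm'
      have h1 := hdom D hD hDA u (by simp [hmem hC hA hCA hu, hmem hC hD hDC.symm hu])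
      have hv : v ∉ (A ∪ D).filter fun w => T.Adj u w := by
        simp [hvA, hmem hB hD hDB.symm hvB]
      have h2 : (insert v ((A ∪ D).filter fun w => T.Adj u w)).card ≤ T.degree u := by
        rw [← card_neighborFinset_eq_degree]
        refine card_le_card fun w hw => ?_
        rcases mem_insert.1 hw with rfl | hw
        · simpa using hvu.symm
        · simpa using (mem_filter.1 hw).2
      rw [card_insert_of_notMem hv] at h2
      omega
  set d := (A.filter fun w => T.Adj v w).card with hd'
  -- With m parts, `b2` reads 4(m - 2) + 1 ≤ n for d = 0 and 2(m - 2) + 2 ≤ n for d = 1.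
  refine ⟨by interval_cases d <;> omega, fun heq => ⟨?_, ?_⟩⟩
  · by_contra h3
    have := b3 (by omega)
    interval_cases d <;> omega
  · obtain ⟨C, hC, hCB, hCA⟩ : ∃ C ∈ P.parts, C ≠ B ∧ C ≠ A := by
      obtain ⟨C, hC⟩ : (P.parts \ {A, B}).Nonempty := by
        rw [← card_pos]
        have h1 := le_card_sdiff {A, B} P.parts
        have h2 : ({A, B} : Finset (Finset V)).card ≤ 2 := card_le_two
        omega
      simp only [mem_sdiff, mem_insert, mem_singleton, not_or] at hC
      exact ⟨C, hC.1, hC.2.2, hC.2.1⟩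
    have h4 := hdom C hC hCA v (by simp [hvA, hmem hB hC hCB.symm hvB])
    rw [card_filter_adj_union (show Disjoint A C from P.disjoint hA hC hCA.symm)] at h4
    -- As d < 2, `C` must supply a neighbour of `v`; both vertices avoid `A`, so neither is a leaf.
    obtain ⟨u, hu⟩ : (C.filter fun w => T.Adj v w).Nonempty := by
      rw [← card_pos]
      omega
    obtain ⟨hu, hvu⟩ := mem_filter.1 hu
    exact ⟨v, u, hvu, hdeg v hvA, hdeg u (hmem hC hA hCA hu)⟩

theorem coalitionNumber_two_le (hT : T.IsTree) [Nontrivial V] :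
    coalitionNumber 2 T ≤ Fintype.card V / 2 + 1 := by
  have := Fintype.one_lt_card (α := V)
  rcases le_or_gt (coalitionNumber 2 T) 2 with h | h
  · omega
  · obtain ⟨P, hP, hcard⟩ := exists_isKCoalitionPartition_of_coalitionNumber_pos
      (show 0 < coalitionNumber 2 T by omega)
    rw [← hcard] at h ⊢
    exact (card_parts_bound hT hP h).1

theorem iso_of_coalitionNumber_two_eq (hT : T.IsTree) [Nontrivial V]
    (heq : coalitionNumber 2 T = Fintype.card V / 2 + 1) :
    Nonempty (T ≃g pathGraph 2) ∨ Nonempty (T ≃g pathGraph 3) ∨ Nonempty (T ≃g pathGraph 4) ∨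
      Nonempty (T ≃g pathGraph 5) ∨ Nonempty (T ≃g doubleStar 1 2) := by
  have hV := Fintype.one_lt_card (α := V)
  rcases le_or_gt (coalitionNumber 2 T) 2 with h | h
  · obtain h2 | h3 : Fintype.card V = 2 ∨ Fintype.card V = 3 := by omega
    · exact Or.inl (nonempty_iso_pathGraph_two hT h2)
    · exact Or.inr (Or.inl (nonempty_iso_pathGraph_three hT h3))
  · obtain ⟨P, hP, hcard⟩ := exists_isKCoalitionPartition_of_coalitionNumber_pos
      (show 0 < coalitionNumber 2 T by omega)
    rw [← hcard] at h heq
    obtain ⟨h3, u, v, huv, hu, hv⟩ := (card_parts_bound hT hP h).2 heq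
    obtain h4 | h5 : Fintype.card V = 4 ∨ Fintype.card V = 5 := by omega
    · exact Or.inr (Or.inr (Or.inl (nonempty_iso_pathGraph_four hT h4 huv hu hv)))
    · exact Or.inr (Or.inr (Or.inr (nonempty_iso_of_card_eq_five hT h5 huv hu hv)))

end UpperBound

/-! ### Optimal partitions of the extremal trees. -/

section Extremal

variable {V : Type*} [Fintype V] [DecidableEq V] {T : SimpleGraph V} [DecidableRel T.Adj]

instance (n : ℕ) : DecidableRel (pathGraph n).Adj :=
  fun _ _ => decidable_of_iff _ pathGraph_adj.symm

instance (a b : ℕ) : DecidableRel (doubleStar a b).Adj := by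
  intro u v
  exact decidable_of_iff _ (fromRel_adj _ u v).symm

instance (k : ℕ) (S : Finset V) : Decidable (IsKDominating T k S) := by
  unfold IsKDominating
  infer_instance

instance (k : ℕ) (A B : Finset V) : Decidable (FormKCoalition T k A B) := by
  unfold FormKCoalition
  infer_instance

theorem le_coalitionNumber_of_iso_pathGraph_two (e : T ≃g pathGraph 2) :
    2 ≤ coalitionNumber 2 T :=
  card_le_coalitionNumber_of_iso (ι := Fin 2) e ![0, 1] (by decide)
    (by decide)

theorem le_coalitionNumber_of_iso_pathGraph_three (e : T ≃g pathGraph 3) :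
    2 ≤ coalitionNumber 2 T :=
  card_le_coalitionNumber_of_iso (ι := Fin 2) e ![0, 1, 1] (by decide)
    (by decide)

theorem le_coalitionNumber_of_iso_pathGraph_four (e : T ≃g pathGraph 4) :
    3 ≤ coalitionNumber 2 T :=
  -- As the upper bound dictates, one colour takes all leaves; likewise for the two trees of order
  -- five.
  card_le_coalitionNumber_of_iso (ι := Fin 3) e ![0, 1, 2, 0] (by decide)
    (by decide)

theorem le_coalitionNumber_of_iso_pathGraph_five (e : T ≃g pathGraph 5) :
    3 ≤ coalitionNumber 2 T :=
  card_le_coalitionNumber_of_iso (ι := Fin 3) e ![0, 1, 2, 1, 0] (by decide)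
    (by decide)

theorem le_coalitionNumber_of_iso_doubleStar_one_two (e : T ≃g doubleStar 1 2) :
    3 ≤ coalitionNumber 2 T :=
  card_le_coalitionNumber_of_iso (ι := Fin 3) e (Sum.elim ![1, 2] fun _ => 0) (by decide)
    (by decide)

end Extremal

end KCoalition

theorem mainTheorem3 {V : Type*} [Fintype V] [DecidableEq V] (T : SimpleGraph V)
    [DecidableRel T.Adj] (hT : T.IsTree) (n : ℕ) (hn : Fintype.card V = n) (hn2 : 2 ≤ n) :
    KCoalition.coalitionNumber 2 T ≤ n / 2 + 1 ∧
    (KCoalition.coalitionNumber 2 T = n / 2 + 1 ↔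
      (Nonempty (T ≃g SimpleGraph.pathGraph 2) ∨
       Nonempty (T ≃g SimpleGraph.pathGraph 3) ∨
       Nonempty (T ≃g SimpleGraph.pathGraph 4) ∨
       Nonempty (T ≃g SimpleGraph.pathGraph 5) ∨
       Nonempty (T ≃g KCoalition.doubleStar 1 2))) := by
  subst hn
  have : Nontrivial V := Fintype.one_lt_card_iff_nontrivial.1 hn2
  have hle := KCoalition.coalitionNumber_two_le hT
  refine ⟨hle, KCoalition.iso_of_coalitionNumber_two_eq hT, ?_⟩
  rintro (⟨⟨e⟩⟩ | ⟨⟨e⟩⟩ | ⟨⟨e⟩⟩ | ⟨⟨e⟩⟩ | ⟨⟨e⟩⟩) <;> have hcard := Fintype.card_congr e.toEquiv <;>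
    simp at hcard <;> refine hle.antisymm ?_ <;> rw [hcard]
  · exact KCoalition.le_coalitionNumber_of_iso_pathGraph_two e
  · exact KCoalition.le_coalitionNumber_of_iso_pathGraph_three e
  · exact KCoalition.le_coalitionNumber_of_iso_pathGraph_four e
  · exact KCoalition.le_coalitionNumber_of_iso_pathGraph_five e
  · exact KCoalition.le_coalitionNumber_of_iso_doubleStar_one_two e
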